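/- Let $\alpha,m,k,a\in\mathbb C$ with $\alpha\neq 0$, $a\ne 0$ and $|\operatorname{Re} m|<1$. Powers and logarithms take their principal values, with $\arg\in(-\pi,\pi]$. Assume that one of the following holds: (i) $0<\arg a\le\pi$; (ii) $a>0$ and $\operatorname{Re}k>-1$; (iii) $k$ is a non-negative integer. Then the integrand below is absolutely integrable along the straight segment from $-\alpha$ to $\alpha$, and $$\int_{-\alpha}^{\alpha}\frac{\left(\frac{\alpha+x}{\alpha-x}\right)^{m}\log^{k}\!\left(\frac{a(\alpha+x)}{\alpha-x}\right)}{\alpha^{2}+x^{2}}\,dx=\frac{\pi^{k+1}e^{\frac12 i\pi(k+m)}\,\Phi\!\left(-e^{im\pi},-k,\frac12-\frac{i\log a}{\pi}\right)}{\alpha}.$$ Here $\Phi$ is the Hurwitz–Lerch zeta function: $\Phi(z,s,b)=\sum_{n=0}^{\infty}\frac{z^{n}}{(b+n)^{s}}$ for $|z|<1$, continued analytically in $z$ to $\mathbb C\setminus[1,\infty)$. When $b=0$ and $-s$ is a non-negative integer (which happens only for $a=-i$ in case (iii)) the term $n=0$ is read as $0^{-s}$ with $0^0=1$. -/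

import Mathlib

/-- The complex plane cut along the real half-line `[1, ∞)`. -/
def lerchDomain : Set ℂ := {z : ℂ | z.re < 1 ∨ z.im ≠ 0}

/-- The Lerch series `∑_{n ≥ 0} zⁿ / (a + n)ˢ` (principal powers). -/
noncomputable def lerchSeries (z s a : ℂ) : ℂ := ∑' n : ℕ, z ^ n / (a + n) ^ s

/-- `F` is the analytic continuation of `z ↦ ∑ zⁿ / (a + n)ˢ` from the open unit disc to the
plane cut along `[1, ∞)`. -/
def IsLerchContinuation (s a : ℂ) (F : ℂ → ℂ) : Prop :=
  DifferentiableOn ℂ F lerchDomain ∧ ∀ z : ℂ, ‖z‖ < 1 → F z = lerchSeries z s a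

theorem isOpen_lerchDomain : IsOpen lerchDomain :=
  (isOpen_lt Complex.continuous_re continuous_const).union
    (isOpen_ne_fun Complex.continuous_im continuous_const)

theorem isPreconnected_lerchDomain : IsPreconnected lerchDomain := by
  have hs : StarConvex ℝ (0 : ℂ) lerchDomain := by
    rw [starConvex_zero_iff]
    intro z hz t ht0 ht1
    rcases hz with hz | hz
    · left
      simp only [Complex.real_smul, Complex.re_ofReal_mul]
      rcases le_or_gt z.re 0 with h | h <;> nlinarith
    · rcases ht0.eq_or_lt with rfl | ht
      · left
        simp
      · right
        simp [ht.ne', hz]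
  exact (hs.isPathConnected (Or.inl (by simp))).isConnected.isPreconnected

/-- The analytic continuation is unique on the cut plane. -/
theorem IsLerchContinuation.eqOn {s a : ℂ} {F G : ℂ → ℂ} (hF : IsLerchContinuation s a F)
    (hG : IsLerchContinuation s a G) : Set.EqOn F G lerchDomain := by
  refine (hF.1.analyticOnNhd isOpen_lerchDomain).eqOn_of_preconnected_of_eventuallyEq
    (hG.1.analyticOnNhd isOpen_lerchDomain) isPreconnected_lerchDomain
    (z₀ := 0) (Or.inl (by simp)) ?_
  filter_upwards [Metric.ball_mem_nhds (0 : ℂ) one_pos] with z hz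
  have hz' : ‖z‖ < 1 := by simpa using hz
  rw [hF.2 z hz', hG.2 z hz']

open Classical in
/-- The Hurwitz-Lerch zeta function `Φ(z, s, a)`: on the plane cut along `[1, ∞)` it is the
analytic continuation in `z` of the Lerch series; on the cut (in particular at `z = 1`) the series
itself is kept. -/
noncomputable def lerchPhi (z s a : ℂ) : ℂ :=
  if z ∈ lerchDomain then Classical.epsilon (IsLerchContinuation s a) z else lerchSeries z s a

/-- Any analytic continuation of the series computes `Φ` on the cut plane. -/
theorem IsLerchContinuation.lerchPhi_eq {s a : ℂ} {F : ℂ → ℂ} (hF : IsLerchContinuation s a F)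
    {z : ℂ} (hz : z ∈ lerchDomain) : lerchPhi z s a = F z := by
  rw [lerchPhi, if_pos hz]
  exact (Classical.epsilon_spec (p := IsLerchContinuation s a) ⟨F, hF⟩).eqOn hF hz

/-- `f` is absolutely integrable along the straight segment from `z` to `w`. -/
def SegmentIntegrable (f : ℂ → ℂ) (z w : ℂ) : Prop :=
  IntervalIntegrable (fun t : ℝ => f (z + t * (w - z)) * (w - z)) MeasureTheory.volume 0 1

/-- The integral `∫_z^w f(x) dx` along the straight segment from `z` to `w`. -/
noncomputable def segmentIntegral (f : ℂ → ℂ) (z w : ℂ) : ℂ :=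
  ∫ t in (0 : ℝ)..1, f (z + t * (w - z)) * (w - z)

/-- Between real end points this is the ordinary integral. -/
theorem segmentIntegral_ofReal (f : ℂ → ℂ) (p q : ℝ) :
    segmentIntegral f p q = ∫ x in p..q, f x := by
  have h := intervalIntegral.smul_integral_comp_add_mul (a := 0) (b := 1)
    (fun x : ℝ => f x) (q - p) p
  simp only [mul_zero, add_zero, mul_one, add_sub_cancel] at h
  rw [← h, segmentIntegral, intervalIntegral.integral_mul_const, Complex.real_smul, mul_comm]
  push_cast
  congr 2
  ext t
  rw [mul_comm (t : ℂ)]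

open MeasureTheory Filter Topology Set

/-! ### Exponential decay and the hyperbolic secant -/

/-! Put x = α tanh(s/2), so that (α + x)/(α - x) = e^s, and write L = log a. The integral becomes
α⁻¹ J(m) with J(m) = ∫ e^{ms} (L + s)^k / (2 cosh s) ds over ℝ, since multiplying a by e^s > 0 adds
exactly s to its principal logarithm (`sigmoid_smul_segment_integrand`).

Raising the line by iπ changes the sign of cosh and crosses one simple pole, at iπ/2. This gives J_L
+ e^{iπm} J_{L+iπ} = π e^{iπm/2} (L + iπ/2)^k (`SubexpHolomorphic.sechTransform_add_shift`). For Im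
m > 0 the ratio z = -e^{iπm} lies in the unit disc, the relation can be iterated, and the remainder
tends to 0. Because L + iπ/2 + iπn = πi(b + n) with b = 1/2 - iL/π, the residue series is a constant
times the Lerch series (`SubexpHolomorphic.sechTransform_eq_tsum`).

Both sides then continue analytically: J is holomorphic for |Re m| < 1, and m ↦ -e^{iπm} maps that
strip bijectively onto ℂ ∖ [0, ∞). Gluing J to the series on the disc yields the continuation of the
series to the cut plane (`lerchPhi_neg_exp_eq`).

The three cases differ only in how w^k is controlled on Im w ≥ Im L. For arg a > 0 the half-plane
avoids the branch cut, and for k ∈ ℕ the power is a polynomial. For a > 0 the line itself meets the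
singularity w = 0, and the series is obtained as a limit from lines slightly above it
(`sechTransform_ofReal_add_cpow_eq_tsum`). -/

theorem integrable_abs_rpow_mul_exp_neg_mul_abs {p c : ℝ} (hp : -1 < p) (hc : 0 < c) :
    Integrable fun x : ℝ => |x| ^ p * Real.exp (-c * |x|) := by
  have h := integrableOn_rpow_mul_exp_neg_mul_rpow hp one_pos hc
  simp only [Real.rpow_one] at h
  have hpos : IntegrableOn (fun x : ℝ => |x| ^ p * Real.exp (-c * |x|)) (Ioi 0) :=
    h.congr_fun (fun x hx => by simp only [abs_of_pos (mem_Ioi.1 hx)]) measurableSet_Ioi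
  rw [← integrableOn_univ, ← Iic_union_Ioi (a := (0 : ℝ)), integrableOn_union]
  refine ⟨?_, hpos⟩
  rw [integrableOn_Iic_iff_integrableOn_Iio]
  refine (IntegrableOn.comp_neg_Iio (c := (0 : ℝ)) (by rwa [neg_zero])).congr_fun
    (fun x _ => ?_) measurableSet_Iio
  simp only [abs_neg x]

theorem integrable_exp_neg_mul_abs {c : ℝ} (hc : 0 < c) :
    Integrable fun x : ℝ => Real.exp (-c * |x|) := by
  simpa using integrable_abs_rpow_mul_exp_neg_mul_abs (p := 0) (by norm_num) hc

theorem Complex.two_mul_cosh (s : ℂ) : 2 * Complex.cosh s = Complex.exp s + Complex.exp (-s) := by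
  rw [Complex.cosh]; ring

theorem Complex.exp_abs_le_norm_two_cosh_ofReal (x : ℝ) :
    Real.exp |x| ≤ ‖2 * Complex.cosh (x : ℂ)‖ := by
  have h : (2 * Complex.cosh (x : ℂ)) = ((Real.exp x + Real.exp (-x) : ℝ) : ℂ) := by
    rw [Complex.two_mul_cosh]; push_cast; rfl
  rw [h, Complex.norm_real, Real.norm_of_nonneg (by positivity)]
  rcases abs_cases x with ⟨hx, -⟩ | ⟨hx, -⟩ <;> rw [hx] <;> linarith [Real.exp_pos x, Real.exp_pos (-x)]

theorem Complex.cosh_ofReal_ne_zero (x : ℝ) : Complex.cosh (x : ℂ) ≠ 0 := by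
  rw [← Complex.ofReal_cosh]
  exact_mod_cast (Real.cosh_pos x).ne'

theorem Complex.exp_abs_sub_le_norm_two_cosh (s : ℂ) :
    Real.exp |s.re| - Real.exp (-|s.re|) ≤ ‖2 * Complex.cosh s‖ := by
  rw [Complex.two_mul_cosh]
  rcases abs_cases s.re with ⟨hx, -⟩ | ⟨hx, -⟩ <;> rw [hx]
  · have := norm_sub_norm_le (Complex.exp s) (-Complex.exp (-s))
    simpa [Complex.norm_exp] using this
  · have := norm_sub_norm_le (Complex.exp (-s)) (-Complex.exp s)
    rw [add_comm]
    simpa [Complex.norm_exp] using this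

theorem Complex.cosh_pi_div_two_mul_I : Complex.cosh (Real.pi / 2 * Complex.I) = 0 := by
  rw [Complex.cosh_mul_I, Complex.cos_pi_div_two]

theorem Complex.eq_of_cosh_eq_zero {s : ℂ} (h0 : 0 ≤ s.im) (h1 : s.im ≤ Real.pi)
    (h : Complex.cosh s = 0) : s = Real.pi / 2 * Complex.I := by
  rw [← Complex.re_add_im s, Complex.cosh_add, Complex.cosh_mul_I, Complex.sinh_mul_I,
    ← Complex.ofReal_cosh, ← Complex.ofReal_sinh, ← Complex.ofReal_cos, ← Complex.ofReal_sin] at h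
  have hre := congrArg Complex.re h
  have him := congrArg Complex.im h
  simp only [Complex.add_re, Complex.mul_re, Complex.mul_im, Complex.ofReal_re, Complex.ofReal_im,
    Complex.I_re, Complex.I_im, Complex.add_im, Complex.zero_re, Complex.zero_im] at hre him
  ring_nf at hre him
  have hcos : Real.cos s.im = 0 := by
    rcases mul_eq_zero.1 hre with h | h
    · exact absurd h (Real.cosh_pos _).ne'
    · exact h
  have hy : s.im = Real.pi / 2 := by
    refine Real.injOn_cos ⟨h0, h1⟩ ⟨by positivity, by linarith [Real.pi_pos]⟩ ?_
    rw [hcos, Real.cos_pi_div_two]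
  rw [hy, Real.sin_pi_div_two, mul_one, Real.sinh_eq_zero] at him
  apply Complex.ext <;> simp [him, hy]

theorem integrable_inv_two_cosh :
    Integrable fun x : ℝ => (2 * Complex.cosh (x : ℂ))⁻¹ := by
  refine (integrable_exp_neg_mul_abs one_pos).mono' ?_ (.of_forall fun x => ?_)
  · refine Continuous.aestronglyMeasurable ?_
    exact Continuous.inv₀ (by fun_prop)
      fun x => mul_ne_zero two_ne_zero (Complex.cosh_ofReal_ne_zero x)
  · rw [norm_inv, neg_one_mul, Real.exp_neg]
    exact inv_anti₀ (Real.exp_pos _) (Complex.exp_abs_le_norm_two_cosh_ofReal x)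

/-- An antiderivative is arctan(e^x). The value supplies the residue constant once the pole has been
subtracted. -/
theorem integral_inv_two_cosh :
    ∫ x : ℝ, (2 * Complex.cosh (x : ℂ))⁻¹ = Real.pi / 2 := by
  have hd : ∀ x : ℝ, HasDerivAt (fun x : ℝ => ((Real.arctan (Real.exp x) : ℝ) : ℂ))
      ((2 * Complex.cosh (x : ℂ))⁻¹) x := by
    intro x
    have h := ((Real.hasDerivAt_exp x).arctan).ofReal_comp
    convert h using 1
    rw [Complex.two_mul_cosh, Complex.exp_neg]
    push_cast
    have h0 := Complex.exp_ne_zero (x : ℂ)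
    have h1 : (1 + Complex.exp (x : ℂ) ^ 2) ≠ 0 := by
      have : (0 : ℝ) < 1 + Real.exp x ^ 2 := by positivity
      exact_mod_cast this.ne'
    have h2 : (Complex.exp (x : ℂ) ^ 2 + 1) ≠ 0 := by rwa [add_comm]
    rw [inv_eq_iff_eq_inv]
    field_simp
    ring
  have hbot : Tendsto (fun x : ℝ => ((Real.arctan (Real.exp x) : ℝ) : ℂ)) atBot (𝓝 0) := by
    have := (Real.continuous_arctan.tendsto 0).comp Real.tendsto_exp_atBot
    rw [Real.arctan_zero] at this
    exact (Complex.continuous_ofReal.tendsto 0).comp this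
  have htop : Tendsto (fun x : ℝ => ((Real.arctan (Real.exp x) : ℝ) : ℂ)) atTop
      (𝓝 ((Real.pi / 2 : ℝ) : ℂ)) := by
    have := (Real.tendsto_arctan_atTop.mono_right nhdsWithin_le_nhds).comp Real.tendsto_exp_atTop
    exact (Complex.continuous_ofReal.tendsto _).comp this
  rw [integral_of_hasDerivAt_of_tendsto hd integrable_inv_two_cosh hbot htop]
  push_cast; ring

/-- A function of exponential growth rate less than one is integrable against `sech`. -/
theorem integrable_div_two_cosh {g : ℝ → ℂ} {C ρ : ℝ} (hρ : ρ < 1)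
    (hg : AEStronglyMeasurable g) (hC : ∀ x, ‖g x‖ ≤ C * Real.exp (ρ * |x|)) :
    Integrable fun x : ℝ => g x / (2 * Complex.cosh (x : ℂ)) := by
  refine ((integrable_exp_neg_mul_abs (sub_pos.2 hρ)).const_mul C).mono' ?_
    (.of_forall fun x => ?_)
  · simp only [div_eq_mul_inv]
    exact hg.mul integrable_inv_two_cosh.aestronglyMeasurable
  · rw [norm_div, div_le_iff₀ ((Real.exp_pos _).trans_le (Complex.exp_abs_le_norm_two_cosh_ofReal x))]
    have hC0 : 0 ≤ C := by simpa using (norm_nonneg _).trans (hC 0)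
    calc ‖g x‖ ≤ C * Real.exp (ρ * |x|) := hC x
      _ = C * Real.exp (-(1 - ρ) * |x|) * Real.exp |x| := by
          rw [mul_assoc, ← Real.exp_add]; ring_nf
      _ ≤ _ := by gcongr; exact Complex.exp_abs_le_norm_two_cosh_ofReal x

/-! ### The contour integral -/

/-- The function `(h s - h (iπ/2)) / (2 cosh s)` with its singularity at `iπ/2` removed. -/
noncomputable def sechQuotient (h : ℂ → ℂ) (s : ℂ) : ℂ :=
  dslope h (Real.pi / 2 * Complex.I) s / (2 * dslope Complex.cosh (Real.pi / 2 * Complex.I) s)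

theorem sechQuotient_of_ne (h : ℂ → ℂ) {s : ℂ} (hs : s ≠ Real.pi / 2 * Complex.I) :
    sechQuotient h s = (h s - h (Real.pi / 2 * Complex.I)) / (2 * Complex.cosh s) := by
  have h0 := sub_ne_zero.2 hs
  rw [sechQuotient, dslope_of_ne _ hs, dslope_of_ne _ hs, slope_def_field, slope_def_field,
    Complex.cosh_pi_div_two_mul_I, sub_zero, ← mul_div_assoc, div_div_div_cancel_right₀ h0]

/-- In the closed strip cosh vanishes only at iπ/2, and simply, its derivative there being i. Hence
dividing out this zero leaves a nonvanishing denominator. -/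
theorem dslope_cosh_ne_zero {s : ℂ} (h0 : 0 ≤ s.im) (h1 : s.im ≤ Real.pi) :
    dslope Complex.cosh (Real.pi / 2 * Complex.I) s ≠ 0 := by
  by_cases hs : s = Real.pi / 2 * Complex.I
  · rw [hs, dslope_same, Complex.deriv_cosh, Complex.sinh_mul_I, Complex.sin_pi_div_two]
    simp
  · rw [dslope_of_ne _ hs, slope_def_field, Complex.cosh_pi_div_two_mul_I, sub_zero]
    exact div_ne_zero (fun h => hs (Complex.eq_of_cosh_eq_zero h0 h1 h)) (sub_ne_zero.2 hs)

theorem continuousAt_sechQuotient {h : ℂ → ℂ}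
    (hd : ∀ s : ℂ, 0 ≤ s.im → s.im ≤ Real.pi → DifferentiableAt ℂ h s) {s : ℂ}
    (h0 : 0 ≤ s.im) (h1 : s.im ≤ Real.pi) : ContinuousAt (sechQuotient h) s := by
  have key : ∀ g : ℂ → ℂ, (∀ s : ℂ, 0 ≤ s.im → s.im ≤ Real.pi → DifferentiableAt ℂ g s) →
      ContinuousAt (dslope g (Real.pi / 2 * Complex.I)) s := by
    intro g hg
    by_cases hs : s = Real.pi / 2 * Complex.I
    · rw [hs, continuousAt_dslope_same]
      exact hs ▸ hg s h0 h1
    · rw [continuousAt_dslope_of_ne hs]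
      exact (hg s h0 h1).continuousAt
  exact (key h hd).div (continuousAt_const.mul
    (key _ fun s _ _ => Complex.differentiable_cosh s))
    (mul_ne_zero two_ne_zero (dslope_cosh_ne_zero h0 h1))

theorem differentiableAt_sechQuotient {h : ℂ → ℂ}
    (hd : ∀ s : ℂ, 0 ≤ s.im → s.im ≤ Real.pi → DifferentiableAt ℂ h s) {s : ℂ}
    (h0 : 0 ≤ s.im) (h1 : s.im ≤ Real.pi) (hs : s ≠ Real.pi / 2 * Complex.I) :
    DifferentiableAt ℂ (sechQuotient h) s :=
  ((differentiableAt_dslope_of_ne hs).2 (hd s h0 h1)).div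
    (((differentiableAt_dslope_of_ne hs).2 (Complex.differentiable_cosh s)).const_mul 2)
    (mul_ne_zero two_ne_zero (dslope_cosh_ne_zero h0 h1))

theorem norm_sechQuotient_le {h : ℂ → ℂ} {C ρ : ℝ} (hρ : 0 ≤ ρ)
    (hC : ∀ s : ℂ, 0 ≤ s.im → s.im ≤ Real.pi → ‖h s‖ ≤ C * Real.exp (ρ * |s.re|))
    {s : ℂ} (h0 : 0 ≤ s.im) (h1 : s.im ≤ Real.pi) (hs : s.re ≠ 0) :
    ‖sechQuotient h s‖ ≤
      2 * C * (Real.exp (ρ * |s.re|) / (Real.exp |s.re| - Real.exp (-|s.re|))) := by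
  have hne : s ≠ Real.pi / 2 * Complex.I := fun h => hs (by rw [h]; simp)
  have hpos : 0 < Real.exp |s.re| - Real.exp (-|s.re|) :=
    sub_pos.2 (Real.exp_lt_exp.2 (by linarith [abs_pos.2 hs]))
  rw [sechQuotient_of_ne h hne, norm_div, ← mul_div_assoc]
  have hc : ‖h (Real.pi / 2 * Complex.I)‖ ≤ C := by
    have him : (Real.pi / 2 * Complex.I : ℂ).im = Real.pi / 2 := by simp
    simpa using hC (Real.pi / 2 * Complex.I) (by rw [him]; positivity)
      (by rw [him]; linarith [Real.pi_pos])
  have hC0 : 0 ≤ C := (norm_nonneg _).trans hc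
  have h1e : 1 ≤ Real.exp (ρ * |s.re|) := Real.one_le_exp (by positivity)
  refine div_le_div₀ (by positivity) ?_ hpos (Complex.exp_abs_sub_le_norm_two_cosh s)
  calc ‖h s - h (Real.pi / 2 * Complex.I)‖ ≤ ‖h s‖ + ‖h (Real.pi / 2 * Complex.I)‖ := norm_sub_le _ _
    _ ≤ C * Real.exp (ρ * |s.re|) + C * 1 := by linarith [hC s h0 h1]
    _ ≤ C * Real.exp (ρ * |s.re|) + C * Real.exp (ρ * |s.re|) := by gcongr
    _ = _ := by ring

theorem tendsto_exp_div_exp_sub_exp {ρ : ℝ} (hρ : ρ < 1) :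
    Tendsto (fun R : ℝ => Real.exp (ρ * R) / (Real.exp R - Real.exp (-R))) atTop (𝓝 0) := by
  have h1 : Tendsto (fun R : ℝ => Real.exp (-((1 - ρ) * R))) atTop (𝓝 0) :=
    Real.tendsto_exp_neg_atTop_nhds_zero.comp (tendsto_id.const_mul_atTop (sub_pos.2 hρ))
  have h2 : Tendsto (fun R : ℝ => 1 - Real.exp (-(2 * R))) atTop (𝓝 (1 - 0)) :=
    tendsto_const_nhds.sub
      (Real.tendsto_exp_neg_atTop_nhds_zero.comp (tendsto_id.const_mul_atTop two_pos))
  have h3 := h1.div h2 (by norm_num)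
  simp only [sub_zero, div_one] at h3
  refine h3.congr fun R => ?_
  simp only [Pi.div_apply]
  have e1 : Real.exp (ρ * R) = Real.exp (-((1 - ρ) * R)) * Real.exp R := by
    rw [← Real.exp_add]; ring_nf
  have e2 : Real.exp R - Real.exp (-R) = (1 - Real.exp (-(2 * R))) * Real.exp R := by
    rw [sub_mul, one_mul, ← Real.exp_add]; ring_nf
  rw [e1, e2, mul_div_mul_right _ _ (Real.exp_pos R).ne']

theorem tendsto_integral_sechQuotient_vertical {h : ℂ → ℂ} {C ρ : ℝ} (hρ0 : 0 ≤ ρ) (hρ : ρ < 1)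
    (hC : ∀ s : ℂ, 0 ≤ s.im → s.im ≤ Real.pi → ‖h s‖ ≤ C * Real.exp (ρ * |s.re|))
    (σ : ℝ) (hσ : |σ| = 1) :
    Tendsto (fun R : ℝ => ∫ y in (0 : ℝ)..Real.pi,
      sechQuotient h (((σ * R : ℝ) : ℂ) + y * Complex.I)) atTop (𝓝 0) := by
  have hlim := ((tendsto_exp_div_exp_sub_exp hρ).const_mul (2 * C)).mul_const Real.pi
  rw [mul_zero, zero_mul] at hlim
  refine squeeze_zero_norm' ?_ hlim
  filter_upwards [eventually_gt_atTop (0 : ℝ)] with R hR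
  have hre : |σ * R| = R := by rw [abs_mul, hσ, one_mul, abs_of_pos hR]
  have := intervalIntegral.norm_integral_le_of_norm_le_const (a := 0) (b := Real.pi)
    (f := fun y : ℝ => sechQuotient h (((σ * R : ℝ) : ℂ) + y * Complex.I))
    (C := 2 * C * (Real.exp (ρ * R) / (Real.exp R - Real.exp (-R)))) ?_
  · rwa [sub_zero, abs_of_pos Real.pi_pos] at this
  · intro y hy
    rw [uIoc_of_le Real.pi_pos.le] at hy
    have hr : (((σ * R : ℝ) : ℂ) + y * Complex.I).re = σ * R := by
      rw [Complex.add_re, Complex.ofReal_re]; simp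
    have hi : (((σ * R : ℝ) : ℂ) + y * Complex.I).im = y := by
      rw [Complex.add_im, Complex.ofReal_im]; simp
    have := norm_sechQuotient_le hρ0 hC (s := ((σ * R : ℝ) : ℂ) + y * Complex.I)
      (by rw [hi]; exact hy.1.le) (by rw [hi]; exact hy.2)
      (by rw [hr]; exact abs_pos.1 (by rw [hre]; exact hR))
    rwa [hr, hre] at this

/-- Residue theorem for `h / (2 cosh)` on the strip `0 ≤ Im s ≤ π`. -/
theorem integral_add_shift_div_two_cosh {h : ℂ → ℂ} {C ρ : ℝ} (hρ0 : 0 ≤ ρ) (hρ : ρ < 1)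
    (hd : ∀ s : ℂ, 0 ≤ s.im → s.im ≤ Real.pi → DifferentiableAt ℂ h s)
    (hC : ∀ s : ℂ, 0 ≤ s.im → s.im ≤ Real.pi → ‖h s‖ ≤ C * Real.exp (ρ * |s.re|)) :
    (Integrable fun x : ℝ => h x / (2 * Complex.cosh (x : ℂ))) ∧
    (Integrable fun x : ℝ => h (x + Real.pi * Complex.I) / (2 * Complex.cosh (x : ℂ))) ∧
    (∫ x : ℝ, h x / (2 * Complex.cosh (x : ℂ))) +
      ∫ x : ℝ, h (x + Real.pi * Complex.I) / (2 * Complex.cosh (x : ℂ)) =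
      Real.pi * h (Real.pi / 2 * Complex.I) := by
  set c : ℂ := Real.pi / 2 * Complex.I with hc
  have hint : ∀ y : ℝ, 0 ≤ y → y ≤ Real.pi →
      Integrable fun x : ℝ => h (x + y * Complex.I) / (2 * Complex.cosh (x : ℂ)) := by
    intro y hy0 hy1
    refine integrable_div_two_cosh (C := C) hρ ?_ fun x => ?_
    · refine Continuous.aestronglyMeasurable (continuous_iff_continuousAt.2 fun x => ?_)
      have hh : ContinuousAt h ((x : ℂ) + y * Complex.I) :=
        (hd _ (by simpa using hy0) (by simpa using hy1)).continuousAt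
      exact ContinuousAt.comp (f := fun x : ℝ => (x : ℂ) + y * Complex.I) hh (by fun_prop)
    · simpa using hC (x + y * Complex.I) (by simpa using hy0) (by simpa using hy1)
  have hi0 : Integrable fun x : ℝ => h x / (2 * Complex.cosh (x : ℂ)) := by
    simpa using hint 0 le_rfl Real.pi_pos.le
  have hi1 := hint Real.pi Real.pi_pos.le le_rfl
  have hic : Integrable fun x : ℝ => h c / (2 * Complex.cosh (x : ℂ)) := by
    simpa only [div_eq_mul_inv] using integrable_inv_two_cosh.const_mul (h c)
  refine ⟨hi0, hi1, ?_⟩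
  have hpi2 : c.im = Real.pi / 2 := by simp [hc]
  have hq0 : (fun x : ℝ => sechQuotient h x) =
      fun x : ℝ => h x / (2 * Complex.cosh (x : ℂ)) - h c / (2 * Complex.cosh (x : ℂ)) := by
    ext x
    rw [sechQuotient_of_ne, sub_div]
    intro hx
    have := congrArg Complex.im hx
    rw [← hc, hpi2, Complex.ofReal_im] at this
    linarith [Real.pi_pos]
  -- Here cosh(x + πi) = -cosh x, so the difference of the two horizontal sides becomes the sum of
  -- the two integrals minus twice that of h(c)/(2 cosh).
  have hq1 : (fun x : ℝ => sechQuotient h (x + Real.pi * Complex.I)) =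
      fun x : ℝ => h c / (2 * Complex.cosh (x : ℂ)) -
        h (x + Real.pi * Complex.I) / (2 * Complex.cosh (x : ℂ)) := by
    ext x
    rw [sechQuotient_of_ne, Complex.cosh_add_pi_mul_I, mul_neg, div_neg, sub_div, neg_sub]
    intro hx
    have := congrArg Complex.im hx
    rw [← hc, hpi2] at this
    simp at this
    linarith [Real.pi_pos]
  have rect : ∀ R : ℝ, 0 < R →
      (∫ x in (-R)..R, sechQuotient h x) -
        (∫ x in (-R)..R, sechQuotient h (x + Real.pi * Complex.I)) +
      Complex.I • (∫ y in (0 : ℝ)..Real.pi, sechQuotient h (((1 * R : ℝ) : ℂ) + y * Complex.I)) -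
      Complex.I • (∫ y in (0 : ℝ)..Real.pi,
        sechQuotient h (((-1 * R : ℝ) : ℂ) + y * Complex.I)) = 0 := by
    intro R hR
    -- Cauchy's theorem in the form that needs only continuity at the exceptional point c.
    have := Complex.integral_boundary_rect_eq_zero_of_differentiable_on_off_countable
      (sechQuotient h) ((-R : ℝ) : ℂ) (R + Real.pi * Complex.I) {c} (countable_singleton c) ?_ ?_
    · simpa using this
    · intro s hs
      have hs2 := hs.2
      simp [uIcc_of_le Real.pi_pos.le] at hs2
      exact (continuousAt_sechQuotient hd hs2.1 hs2.2).continuousWithinAt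
    · rintro s ⟨hs, hsc⟩
      have hs2 := hs.2
      simp [Real.pi_pos.le] at hs2
      exact differentiableAt_sechQuotient hd hs2.1.le hs2.2.le hsc
  have hI0 : Integrable fun x : ℝ => sechQuotient h x := by
    rw [hq0]; exact hi0.sub hic
  have hI1 : Integrable fun x : ℝ => sechQuotient h (x + Real.pi * Complex.I) := by
    rw [hq1]; exact hic.sub hi1
  have l0 := intervalIntegral_tendsto_integral hI0 tendsto_neg_atTop_atBot tendsto_id
  have l1 := intervalIntegral_tendsto_integral hI1 tendsto_neg_atTop_atBot tendsto_id
  have l2 := (tendsto_integral_sechQuotient_vertical hρ0 hρ hC 1 (by simp)).const_smul Complex.I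
  have l3 := (tendsto_integral_sechQuotient_vertical hρ0 hρ hC (-1) (by simp)).const_smul Complex.I
  have l := ((l0.sub l1).add l2).sub l3
  have hz := tendsto_nhds_unique (l.congr' (f₂ := fun _ => (0 : ℂ)) (by
    filter_upwards [eventually_gt_atTop (0 : ℝ)] with R hR
    exact rect R hR)) tendsto_const_nhds
  have hci : ∫ x : ℝ, h c / (2 * Complex.cosh (x : ℂ)) = h c * (Real.pi / 2) := by
    rw [← integral_inv_two_cosh, ← integral_const_mul]
    simp only [div_eq_mul_inv]
  rw [hq0, hq1, integral_sub hi0 hic, integral_sub hic hi1, hci] at hz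
  simp only [smul_zero, add_zero, sub_zero] at hz
  linear_combination hz

/-! ### The two-sided Laplace transform against `sech` -/

/-- `φ` is integrable against every exponentially decaying weight. -/
def SubexpIntegrable (φ : ℝ → ℂ) : Prop :=
  ∀ ε : ℝ, 0 < ε → Integrable fun s : ℝ => (Real.exp (-ε * |s|) : ℂ) * φ s

/-- The integral `∫ e^{ms} φ(s) / (2 cosh s) ds` over the real line. -/
noncomputable def sechTransform (φ : ℝ → ℂ) (m : ℂ) : ℂ :=
  ∫ s : ℝ, Complex.exp (m * s) * φ s / (2 * Complex.cosh (s : ℂ))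

theorem SubexpIntegrable.aestronglyMeasurable {φ : ℝ → ℂ} (h : SubexpIntegrable φ) :
    AEStronglyMeasurable φ := by
  have hc : Continuous fun s : ℝ => (Real.exp |s| : ℂ) := by fun_prop
  refine (hc.aestronglyMeasurable.mul (h 1 one_pos).aestronglyMeasurable).congr
    (.of_forall fun s => ?_)
  simp only [Pi.mul_apply]
  rw [← mul_assoc, ← Complex.ofReal_mul, ← Real.exp_add]
  simp

theorem SubexpIntegrable.norm {φ : ℝ → ℂ} (h : SubexpIntegrable φ) {ε : ℝ} (hε : 0 < ε) :
    Integrable fun s : ℝ => Real.exp (-ε * |s|) * ‖φ s‖ := by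
  refine (h ε hε).norm.congr (.of_forall fun s => ?_)
  simp only [norm_mul, Complex.norm_real, Real.norm_eq_abs, Real.abs_exp]

theorem subexpIntegrable_of_norm_le {φ : ℝ → ℂ} (hm : AEStronglyMeasurable φ)
    (h : ∀ ε : ℝ, 0 < ε → ∃ g : ℝ → ℝ, (Integrable fun s => Real.exp (-ε * |s|) * g s) ∧
      ∀ᵐ s : ℝ, ‖φ s‖ ≤ g s) : SubexpIntegrable φ := by
  intro ε hε
  obtain ⟨g, hg, hle⟩ := h ε hε
  refine hg.mono' ?_ ?_
  · exact (by fun_prop : Continuous fun s : ℝ => (Real.exp (-ε * |s|) : ℂ)).aestronglyMeasurable.mul hm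
  · filter_upwards [hle] with s hs
    rw [norm_mul, Complex.norm_real, Real.norm_eq_abs, Real.abs_exp]
    gcongr

theorem norm_exp_mul_le (m : ℂ) (s : ℝ) :
    ‖Complex.exp (m * s)‖ ≤ Real.exp (|m.re| * |s|) := by
  rw [Complex.norm_exp, Real.exp_le_exp, ← abs_mul]
  simpa using le_abs_self (m.re * s)

theorem norm_sechTransform_integrand_le (φ : ℝ → ℂ) (m : ℂ) (s : ℝ) :
    ‖Complex.exp (m * s) * φ s / (2 * Complex.cosh (s : ℂ))‖ ≤
      Real.exp (-(1 - |m.re|) * |s|) * ‖φ s‖ := by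
  rw [norm_div, norm_mul,
    div_le_iff₀ ((Real.exp_pos _).trans_le (Complex.exp_abs_le_norm_two_cosh_ofReal s))]
  calc ‖Complex.exp (m * s)‖ * ‖φ s‖ ≤ Real.exp (|m.re| * |s|) * ‖φ s‖ := by
        gcongr; exact norm_exp_mul_le m s
    _ = Real.exp (-(1 - |m.re|) * |s|) * ‖φ s‖ * Real.exp |s| := by
        rw [mul_right_comm, ← Real.exp_add]; ring_nf
    _ ≤ _ := by gcongr; exact Complex.exp_abs_le_norm_two_cosh_ofReal s

theorem aestronglyMeasurable_sechTransform_integrand {φ : ℝ → ℂ} (hφ : AEStronglyMeasurable φ)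
    (m : ℂ) : AEStronglyMeasurable fun s : ℝ =>
      Complex.exp (m * s) * φ s / (2 * Complex.cosh (s : ℂ)) := by
  simp only [div_eq_mul_inv]
  exact ((by fun_prop : Continuous fun s : ℝ => Complex.exp (m * s)).aestronglyMeasurable.mul
    hφ).mul integrable_inv_two_cosh.aestronglyMeasurable

theorem SubexpIntegrable.integrable_sechTransform {φ : ℝ → ℂ} (h : SubexpIntegrable φ) {m : ℂ}
    (hm : |m.re| < 1) :
    Integrable fun s : ℝ => Complex.exp (m * s) * φ s / (2 * Complex.cosh (s : ℂ)) :=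
  (h.norm (sub_pos.2 hm)).mono'
    (aestronglyMeasurable_sechTransform_integrand h.aestronglyMeasurable m)
    (.of_forall fun s => norm_sechTransform_integrand_le φ m s)

theorem SubexpIntegrable.differentiableAt_sechTransform {φ : ℝ → ℂ} (h : SubexpIntegrable φ)
    {m : ℂ} (hm : |m.re| < 1) : DifferentiableAt ℂ (sechTransform φ) m := by
  -- The spare decay 3δ is split in three: one δ for moving m within the ball, one to absorb the
  -- factor s produced by differentiation, one left for integrability.
  set δ : ℝ := (1 - |m.re|) / 3 with hδ
  have hδ0 : 0 < δ := by rw [hδ]; linarith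
  have hmeas := h.aestronglyMeasurable
  refine (hasDerivAt_integral_of_dominated_loc_of_deriv_le (μ := volume) (s := Metric.ball m δ)
    (x₀ := m) (F := fun m (s : ℝ) => Complex.exp (m * s) * φ s / (2 * Complex.cosh (s : ℂ)))
    (F' := fun m (s : ℝ) => Complex.exp (m * s) * (s * φ s) / (2 * Complex.cosh (s : ℂ)))
    (bound := fun s => δ⁻¹ * (Real.exp (-δ * |s|) * ‖φ s‖))
    (Metric.ball_mem_nhds m hδ0)
    (.of_forall fun m => aestronglyMeasurable_sechTransform_integrand hmeas m)
    (h.integrable_sechTransform hm)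
    (aestronglyMeasurable_sechTransform_integrand
      (Complex.continuous_ofReal.aestronglyMeasurable.mul hmeas) m)
    (.of_forall fun s m' hm' => ?_) ((h.norm hδ0).const_mul _)
    (.of_forall fun s m' _ => ?_)).2.differentiableAt
  · refine (norm_sechTransform_integrand_le (fun s : ℝ => (s : ℂ) * φ s) m' s).trans ?_
    have h1 : |m'.re| ≤ |m.re| + δ := by
      have h2 := (Complex.abs_re_le_norm (m' - m)).trans (mem_ball_iff_norm.1 hm').le
      rw [Complex.sub_re] at h2
      have := abs_sub_abs_le_abs_sub m'.re m.re
      linarith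
    have h2 : -(1 - |m'.re|) * |s| ≤ -(2 * δ) * |s| := by
      gcongr; rw [hδ]; rw [hδ] at h1; linarith
    have h3 : |s| ≤ δ⁻¹ * Real.exp (δ * |s|) := by
      rw [inv_mul_eq_div, le_div_iff₀ hδ0]
      linarith [Real.add_one_le_exp (δ * |s|)]
    rw [norm_mul, Complex.norm_real, Real.norm_eq_abs]
    calc Real.exp (-(1 - |m'.re|) * |s|) * (|s| * ‖φ s‖)
        ≤ Real.exp (-(2 * δ) * |s|) * (δ⁻¹ * Real.exp (δ * |s|) * ‖φ s‖) := by gcongr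
      _ = δ⁻¹ * ((Real.exp (-(2 * δ) * |s|) * Real.exp (δ * |s|)) * ‖φ s‖) := by ring
      _ = _ := by rw [← Real.exp_add]; ring_nf
  · have h1 : HasDerivAt (fun m : ℂ => m * (s : ℂ)) s m' := by
      simpa using (hasDerivAt_id m').mul_const (s : ℂ)
    have := (h1.cexp.mul_const (φ s)).div_const (2 * Complex.cosh (s : ℂ))
    rwa [mul_assoc] at this

/-! ### Functions of subexponential growth on a half-plane -/

/-- `f` is holomorphic and of subexponential growth on the half-plane `y ≤ Im w`. -/
structure SubexpHolomorphic (f : ℂ → ℂ) (y : ℝ) : Prop where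
  differentiableAt : ∀ w : ℂ, y ≤ w.im → DifferentiableAt ℂ f w
  growth : ∀ ε : ℝ, 0 < ε → ∃ C : ℝ, ∀ w : ℂ, y ≤ w.im → ‖f w‖ ≤ C * Real.exp (ε * ‖w‖)

theorem SubexpHolomorphic.mono {f : ℂ → ℂ} {y y' : ℝ} (h : SubexpHolomorphic f y) (hy : y ≤ y') :
    SubexpHolomorphic f y' where
  differentiableAt w hw := h.differentiableAt w (hy.trans hw)
  growth ε hε := (h.growth ε hε).imp fun _ hC w hw => hC w (hy.trans hw)

theorem SubexpHolomorphic.exists_growth {f : ℂ → ℂ} {y : ℝ} (h : SubexpHolomorphic f y) {ε : ℝ}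
    (hε : 0 < ε) :
    ∃ C : ℝ, 0 ≤ C ∧ ∀ w : ℂ, y ≤ w.im → ‖f w‖ ≤ C * Real.exp (ε * ‖w‖) := by
  obtain ⟨C, hC⟩ := h.growth ε hε
  exact ⟨max C 0, le_max_right _ _, fun w hw => (hC w hw).trans (by gcongr; exact le_max_left _ _)⟩

theorem SubexpHolomorphic.subexpIntegrable {f : ℂ → ℂ} {L : ℂ} (h : SubexpHolomorphic f L.im) :
    SubexpIntegrable fun s : ℝ => f (L + s) := by
  refine subexpIntegrable_of_norm_le ?_ fun ε hε => ?_
  · refine Continuous.aestronglyMeasurable (continuous_iff_continuousAt.2 fun s => ?_)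
    exact ContinuousAt.comp (f := fun s : ℝ => L + (s : ℂ))
      (h.differentiableAt (L + s) (by simp)).continuousAt (by fun_prop)
  · obtain ⟨C, hC0, hC⟩ := h.exists_growth (half_pos hε)
    refine ⟨fun s => C * Real.exp (ε / 2 * ‖L‖) * Real.exp (ε / 2 * |s|), ?_, .of_forall fun s => ?_⟩
    · refine ((integrable_exp_neg_mul_abs (half_pos hε)).const_mul
        (C * Real.exp (ε / 2 * ‖L‖))).congr (.of_forall fun s => ?_)
      simp only
      rw [mul_left_comm, ← Real.exp_add]; ring_nf
    · refine (hC _ (by simp)).trans ?_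
      simp only
      rw [mul_assoc, ← Real.exp_add, ← mul_add]
      gcongr
      simpa using norm_add_le L (s : ℂ)

theorem SubexpHolomorphic.sechTransform_add_shift {f : ℂ → ℂ} {L m : ℂ}
    (h : SubexpHolomorphic f L.im) (hm : |m.re| < 1) :
    sechTransform (fun s => f (L + s)) m +
      Complex.exp (m * (Real.pi * Complex.I)) *
        sechTransform (fun s => f (L + Real.pi * Complex.I + s)) m =
      Real.pi * (Complex.exp (m * (Real.pi / 2 * Complex.I)) *
        f (L + Real.pi / 2 * Complex.I)) := by
  -- Half of the gap, so that the total growth rate |Re m| + ε stays below 1.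
  set ε : ℝ := (1 - |m.re|) / 2 with hε
  have hε0 : 0 < ε := by rw [hε]; linarith
  obtain ⟨C, hC0, hC⟩ := h.exists_growth hε0
  have key := integral_add_shift_div_two_cosh (h := fun s => Complex.exp (m * s) * f (L + s))
    (C := Real.exp (|m.im| * Real.pi) * (C * Real.exp (ε * (‖L‖ + Real.pi)))) (ρ := |m.re| + ε)
    (by positivity) (by rw [hε]; linarith) ?_ ?_
  · rw [← key.2.2, sechTransform, sechTransform, ← integral_const_mul]
    congr 2
    ext s
    rw [mul_add, Complex.exp_add, add_assoc, add_comm (Real.pi * Complex.I : ℂ)]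
    ring
  · intro s h0 _
    have h1 : DifferentiableAt ℂ f (L + s) := h.differentiableAt _ (by simpa using h0)
    have h2 : DifferentiableAt ℂ (fun s => f (L + s)) s :=
      DifferentiableAt.comp s (f := fun s : ℂ => L + s) h1 (by fun_prop)
    exact DifferentiableAt.mul (by fun_prop) h2
  · intro s h0 h1
    have e1 : ‖Complex.exp (m * s)‖ ≤ Real.exp (|m.re| * |s.re|) * Real.exp (|m.im| * Real.pi) := by
      rw [Complex.norm_exp, ← Real.exp_add, Real.exp_le_exp, Complex.mul_re, ← abs_mul]
      have a1 := le_abs_self (m.re * s.re)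
      have a2 : -(m.im * s.im) ≤ |m.im| * Real.pi := by
        refine (neg_le_abs _).trans ?_
        rw [abs_mul, abs_of_nonneg h0]
        gcongr
      linarith
    have e2 : ‖f (L + s)‖ ≤ C * (Real.exp (ε * (‖L‖ + Real.pi)) * Real.exp (ε * |s.re|)) := by
      refine (hC _ (by simpa using h0)).trans ?_
      rw [← Real.exp_add, ← mul_add]
      gcongr
      have a1 := norm_add_le L s
      have a2 := Complex.norm_le_abs_re_add_abs_im s
      rw [abs_of_nonneg h0] at a2
      linarith
    rw [norm_mul]
    refine (mul_le_mul e1 e2 (norm_nonneg _) (by positivity)).trans_eq ?_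
    rw [add_mul, Real.exp_add]
    ring

theorem SubexpHolomorphic.norm_shift_le {f : ℂ → ℂ} {L : ℂ} (h : SubexpHolomorphic f L.im)
    {ε : ℝ} (hε : 0 < ε) :
    ∃ C : ℝ, 0 ≤ C ∧ ∀ (y : ℝ) (s : ℝ), 0 ≤ y →
      ‖f (L + y * Complex.I + s)‖ ≤ C * Real.exp (ε * y) * Real.exp (ε * |s|) := by
  obtain ⟨C, hC0, hC⟩ := h.exists_growth hε
  refine ⟨C * Real.exp (ε * ‖L‖), by positivity, fun y s hy => (hC _ (by simpa using hy)).trans ?_⟩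
  rw [mul_assoc, mul_assoc, ← Real.exp_add, ← Real.exp_add, ← mul_add, ← mul_add]
  gcongr
  have a1 := norm_add_le (L + y * Complex.I) (s : ℂ)
  have a2 := norm_add_le L (y * Complex.I)
  simp only [norm_mul, Complex.norm_real, Real.norm_eq_abs, Complex.norm_I, mul_one,
    abs_of_nonneg hy] at a1 a2
  linarith

/-- Each step of height π multiplies the bound on f by e^{επ}, which the geometric factor r must
beat. The condition ε < δ keeps the horizontal integrals convergent. -/
theorem exists_mul_exp_lt_one {r δ : ℝ} (hr : r < 1) (hδ : 0 < δ) :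
    ∃ ε : ℝ, 0 < ε ∧ r * Real.exp (ε * Real.pi) < 1 ∧ ε < δ := by
  have hc : ContinuousAt (fun ε : ℝ => r * Real.exp (ε * Real.pi)) 0 := by fun_prop
  have := hc.tendsto.eventually_lt_const (u := 1) (by simpa using hr)
  obtain ⟨ε, ⟨h1, h2⟩, h3⟩ := (((this.and (eventually_lt_nhds hδ)).filter_mono
    nhdsWithin_le_nhds).and (self_mem_nhdsWithin (s := Ioi 0))).exists
  exact ⟨ε, h3, h1, h2⟩

theorem SubexpHolomorphic.summable_pow_mul {f : ℂ → ℂ} {L z : ℂ} (h : SubexpHolomorphic f L.im)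
    (hz : ‖z‖ < 1) {y : ℝ} (hy : 0 ≤ y) :
    Summable fun n : ℕ => ‖z‖ ^ n * ‖f (L + (y + Real.pi * n : ℝ) * Complex.I)‖ := by
  obtain ⟨ε, hε, hr, -⟩ := exists_mul_exp_lt_one hz one_pos
  obtain ⟨C, hC0, hC⟩ := h.norm_shift_le hε
  refine Summable.of_nonneg_of_le (fun n => by positivity) (fun n => ?_)
    ((summable_geometric_of_lt_one (by positivity) hr).mul_left (C * Real.exp (ε * y)))
  have := hC (y + Real.pi * n) 0 (by positivity)
  simp only [Complex.ofReal_zero, add_zero, abs_zero, mul_zero, Real.exp_zero, mul_one] at this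
  refine (mul_le_mul_of_nonneg_left this (by positivity)).trans_eq ?_
  rw [mul_add, Real.exp_add, mul_pow, ← Real.exp_nat_mul]
  ring_nf

theorem SubexpHolomorphic.tendsto_pow_mul_sechTransform {f : ℂ → ℂ} {L m z : ℂ}
    (h : SubexpHolomorphic f L.im) (hm : |m.re| < 1) (hz : ‖z‖ < 1) :
    Tendsto (fun n : ℕ => z ^ n *
      sechTransform (fun s => f (L + (Real.pi * n : ℝ) * Complex.I + s)) m) atTop (𝓝 0) := by
  obtain ⟨ε, hε, hr, hε1⟩ := exists_mul_exp_lt_one hz (sub_pos.2 hm)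
  obtain ⟨C, hC0, hC⟩ := h.norm_shift_le hε
  have hK := integrable_exp_neg_mul_abs (sub_pos.2 hε1)
  set K := ∫ s : ℝ, Real.exp (-(1 - |m.re| - ε) * |s|)
  have hlim := (tendsto_pow_atTop_nhds_zero_of_lt_one (by positivity) hr).mul_const (C * K)
  rw [zero_mul] at hlim
  refine squeeze_zero_norm (fun n => ?_) hlim
  have hb : ‖sechTransform (fun s => f (L + (Real.pi * n : ℝ) * Complex.I + s)) m‖ ≤
      C * Real.exp (ε * (Real.pi * n)) * K := by
    rw [← integral_const_mul]
    refine norm_integral_le_of_norm_le (hK.const_mul _) (.of_forall fun s => ?_)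
    refine (norm_sechTransform_integrand_le
      (fun s : ℝ => f (L + (Real.pi * n : ℝ) * Complex.I + s)) m s).trans ?_
    refine (mul_le_mul_of_nonneg_left (hC (Real.pi * n) s (by positivity))
      (Real.exp_pos _).le).trans_eq ?_
    rw [mul_left_comm, ← Real.exp_add]
    ring_nf
  rw [norm_mul, norm_pow]
  refine (mul_le_mul_of_nonneg_left hb (by positivity)).trans_eq ?_
  rw [mul_pow, ← Real.exp_nat_mul]
  ring_nf

/-- The residue series of the transform, for `Im m > 0`. -/
theorem SubexpHolomorphic.sechTransform_eq_tsum {f : ℂ → ℂ} {L m : ℂ}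
    (h : SubexpHolomorphic f L.im) (hm : |m.re| < 1) (hm0 : 0 < m.im) :
    sechTransform (fun s => f (L + s)) m =
      Real.pi * Complex.exp (m * (Real.pi / 2 * Complex.I)) *
        ∑' n : ℕ, (-Complex.exp (m * (Real.pi * Complex.I))) ^ n *
          f (L + (Real.pi / 2 + Real.pi * n : ℝ) * Complex.I) := by
  set z := -Complex.exp (m * (Real.pi * Complex.I)) with hz
  set e := Complex.exp (m * (Real.pi / 2 * Complex.I))
  have hz1 : ‖z‖ < 1 := by
    rw [hz, norm_neg, Complex.norm_exp, Real.exp_lt_one_iff]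
    simpa using mul_pos hm0 Real.pi_pos
  set J : ℕ → ℂ := fun n => sechTransform (fun s => f (L + (Real.pi * n : ℝ) * Complex.I + s)) m
  have hJ : ∀ n : ℕ, J n - z * J (n + 1) =
      Real.pi * e * f (L + (Real.pi / 2 + Real.pi * n : ℝ) * Complex.I) := by
    intro n
    have h1 : L.im ≤ (L + (Real.pi * n : ℝ) * Complex.I).im := by
      have : 0 ≤ Real.pi * n := by positivity
      simpa using this
    have h2 := (h.mono h1).sechTransform_add_shift hm
    rw [hz, neg_mul, sub_neg_eq_add, mul_assoc]
    convert h2 using 3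
    · simp only [J]
      congr 1
      ext s
      push_cast
      ring_nf
    · push_cast; ring_nf
  -- The one-step relation multiplied by zⁿ telescopes.
  have hpart : ∀ N : ℕ, ∑ n ∈ Finset.range N, Real.pi * e * (z ^ n *
      f (L + (Real.pi / 2 + Real.pi * n : ℝ) * Complex.I)) = J 0 - z ^ N * J N := by
    intro N
    induction N with
    | zero => simp
    | succ N ih =>
      rw [Finset.sum_range_succ, ih, mul_left_comm, ← hJ N, pow_succ]
      ring
  have hsum : Summable fun n : ℕ => z ^ n *
      f (L + (Real.pi / 2 + Real.pi * n : ℝ) * Complex.I) := by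
    refine Summable.of_norm ?_
    simpa only [norm_mul, norm_pow] using
      h.summable_pow_mul hz1 (y := Real.pi / 2) (by positivity)
  have l1 := (hsum.mul_left (Real.pi * e)).hasSum.tendsto_sum_nat
  simp only [hpart] at l1
  have l2 := (tendsto_const_nhds (x := J 0)).sub (h.tendsto_pow_mul_sechTransform hm hz1)
  rw [sub_zero] at l2
  have := tendsto_nhds_unique l2 l1
  rw [tsum_mul_left] at this
  rw [← this]
  simp [J]

/-! ### Growth of complex powers -/

theorem Complex.norm_cpow_le_exp_mul_rpow (w k : ℂ) :
    ‖w ^ k‖ ≤ Real.exp (Real.pi * |k.im|) * ‖w‖ ^ k.re := by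
  refine (Complex.norm_cpow_le w k).trans ?_
  rw [div_eq_inv_mul, ← Real.exp_neg]
  gcongr
  refine (neg_le_abs _).trans ?_
  rw [abs_mul]
  gcongr
  exact Complex.abs_arg_le_pi w

theorem exists_rpow_le_mul_exp {p ε : ℝ} (hp : 0 ≤ p) (hε : 0 < ε) :
    ∃ C : ℝ, 0 ≤ C ∧ ∀ x : ℝ, 0 ≤ x → x ^ p ≤ C * Real.exp (ε * x) := by
  rcases hp.eq_or_lt with rfl | hp
  · exact ⟨1, zero_le_one, fun x hx => by simpa using mul_nonneg hε.le hx⟩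
  -- The constant comes from raising x ≤ (p/ε) e^{(ε/p) x} to the power p.
  · refine ⟨(p / ε) ^ p, by positivity, fun x hx => ?_⟩
    have h1 : x ≤ p / ε * Real.exp (ε / p * x) := by
      have := Real.add_one_le_exp (ε / p * x)
      calc x = p / ε * (ε / p * x) := by field_simp
        _ ≤ _ := by gcongr; linarith
    refine (Real.rpow_le_rpow hx h1 hp.le).trans_eq ?_
    rw [Real.mul_rpow (by positivity) (Real.exp_pos _).le, ← Real.exp_mul]
    congr 2
    field_simp

theorem Complex.exists_norm_cpow_le_mul_exp {k : ℂ} (hk : 0 ≤ k.re) {ε : ℝ} (hε : 0 < ε) :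
    ∃ C : ℝ, 0 ≤ C ∧ ∀ w : ℂ, ‖w ^ k‖ ≤ C * Real.exp (ε * ‖w‖) := by
  obtain ⟨C, hC0, hC⟩ := exists_rpow_le_mul_exp hk hε
  refine ⟨Real.exp (Real.pi * |k.im|) * C, by positivity, fun w => ?_⟩
  refine (Complex.norm_cpow_le_exp_mul_rpow w k).trans ?_
  rw [mul_assoc]
  gcongr
  exact hC _ (norm_nonneg w)

/-- The condition y > 0 serves twice: the half-plane misses the branch cut, and ‖w‖ ≥ y bounds the
power when Re k < 0. -/
theorem subexpHolomorphic_cpow (k : ℂ) {y : ℝ} (hy : 0 < y) :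
    SubexpHolomorphic (fun w => w ^ k) y where
  differentiableAt w hw :=
    DifferentiableAt.cpow_const differentiableAt_id (Or.inr (hy.trans_le hw).ne')
  growth ε hε := by
    rcases le_or_gt 0 k.re with hk | hk
    · obtain ⟨C, -, hC⟩ := Complex.exists_norm_cpow_le_mul_exp hk hε
      exact ⟨C, fun w _ => hC w⟩
    · refine ⟨Real.exp (Real.pi * |k.im|) * y ^ k.re, fun w hw => ?_⟩
      refine (Complex.norm_cpow_le_exp_mul_rpow w k).trans ?_
      rw [mul_assoc]
      gcongr
      refine (Real.rpow_le_rpow_of_nonpos hy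
        (hw.trans ((le_abs_self _).trans (Complex.abs_im_le_norm w))) hk.le).trans ?_
      exact le_mul_of_one_le_right (by positivity) (Real.one_le_exp (by positivity))

theorem subexpHolomorphic_cpow_natCast (n : ℕ) (y : ℝ) :
    SubexpHolomorphic (fun w => w ^ (n : ℂ)) y where
  differentiableAt w _ := by
    simp only [Complex.cpow_natCast]
    fun_prop
  growth ε hε := by
    obtain ⟨C, -, hC⟩ := Complex.exists_norm_cpow_le_mul_exp (k := n) (by simp) hε
    exact ⟨C, fun w _ => hC w⟩

/-! ### The boundary case of a real shift -/

theorem integrable_exp_neg_mul_abs_mul_abs_add_rpow {p ε : ℝ} (hp : -1 < p) (hε : 0 < ε) (x₀ : ℝ) :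
    Integrable fun s : ℝ => Real.exp (-ε * |s|) * |x₀ + s| ^ p := by
  have h := ((integrable_abs_rpow_mul_exp_neg_mul_abs hp hε).comp_add_left x₀).const_mul
    (Real.exp (ε * |x₀|))
  refine h.mono' ?_ (.of_forall fun s => ?_)
  · refine AEStronglyMeasurable.mul (by fun_prop) ?_
    exact (by fun_prop : Measurable fun s : ℝ => |x₀ + s| ^ p).aestronglyMeasurable
  · rw [Real.norm_of_nonneg (by positivity), mul_left_comm, ← Real.exp_add, mul_comm]
    gcongr
    have := abs_add_le x₀ s
    nlinarith

/-- One majorant for all heights 0 ≤ y ≤ 1, as dominated convergence for y → 0⁺ requires. For Re k <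
0 it rests on ‖w‖ ≥ |Re w|, and -1 < Re k makes the singularity integrable. -/
theorem exists_integrable_bound_cpow {k : ℂ} (hk : -1 < k.re) (x₀ : ℝ) {ε : ℝ} (hε : 0 < ε) :
    ∃ g : ℝ → ℝ, (Integrable fun s => Real.exp (-ε * |s|) * g s) ∧
      ∀ y : ℝ, 0 ≤ y → y ≤ 1 → ∀ᵐ s : ℝ, ‖((x₀ : ℂ) + y * Complex.I + s) ^ k‖ ≤ g s := by
  rcases le_or_gt 0 k.re with hk0 | hk0
  · obtain ⟨C, hC0, hC⟩ := Complex.exists_norm_cpow_le_mul_exp hk0 (half_pos hε)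
    refine ⟨fun s => C * Real.exp (ε / 2 * (|x₀| + 1)) * Real.exp (ε / 2 * |s|), ?_,
      fun y hy0 hy1 => .of_forall fun s => (hC _).trans ?_⟩
    · refine ((integrable_exp_neg_mul_abs (half_pos hε)).const_mul
        (C * Real.exp (ε / 2 * (|x₀| + 1)))).congr (.of_forall fun s => ?_)
      simp only
      rw [mul_left_comm, ← Real.exp_add]; ring_nf
    · simp only
      rw [mul_assoc, ← Real.exp_add, ← mul_add]
      gcongr
      have a1 := norm_add_le ((x₀ : ℂ) + y * Complex.I) (s : ℂ)
      have a2 := norm_add_le (x₀ : ℂ) (y * Complex.I)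
      simp only [norm_mul, Complex.norm_real, Real.norm_eq_abs, Complex.norm_I, mul_one,
        abs_of_nonneg hy0] at a1 a2
      linarith
  · refine ⟨fun s => Real.exp (Real.pi * |k.im|) * |x₀ + s| ^ k.re, ?_, fun y _ _ => ?_⟩
    · simpa only [mul_left_comm] using
        (integrable_exp_neg_mul_abs_mul_abs_add_rpow hk hε x₀).const_mul
          (Real.exp (Real.pi * |k.im|))
    -- At s = -x₀ the real power takes the default value 0, so the bound fails there for y > 0.
    · filter_upwards [Measure.ae_ne volume (-x₀)] with s hs
      refine (Complex.norm_cpow_le_exp_mul_rpow _ k).trans ?_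
      refine mul_le_mul_of_nonneg_left ?_ (Real.exp_pos _).le
      refine Real.rpow_le_rpow_of_nonpos (abs_pos.2 fun h => hs (eq_neg_of_add_eq_zero_right h)) ?_ hk0.le
      refine le_trans (by simp) (Complex.abs_re_le_norm _)

theorem subexpIntegrable_ofReal_add_cpow {k : ℂ} (hk : -1 < k.re) (x₀ : ℝ) :
    SubexpIntegrable fun s : ℝ => ((x₀ : ℂ) + s) ^ k := by
  refine subexpIntegrable_of_norm_le ?_ fun ε hε => ?_
  · exact (by fun_prop : Measurable fun s : ℝ => ((x₀ : ℂ) + s) ^ k).aestronglyMeasurable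
  · obtain ⟨g, hg, hle⟩ := exists_integrable_bound_cpow hk x₀ hε
    exact ⟨g, hg, by simpa using hle 0 le_rfl zero_le_one⟩

/-- Since arg takes the value π on the negative axis, the principal logarithm is continuous there
from above. -/
theorem Complex.continuousWithinAt_cpow_const_upper {w : ℂ} (hw : w ≠ 0) (k : ℂ) :
    ContinuousWithinAt (fun w => w ^ k) {w : ℂ | 0 ≤ w.im} w := by
  have hlog : ContinuousWithinAt Complex.log {w : ℂ | 0 ≤ w.im} w := by
    by_cases hs : w ∈ Complex.slitPlane
    · exact (continuousAt_clog hs).continuousWithinAt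
    · rw [Complex.mem_slitPlane_iff, not_or, not_lt, not_not] at hs
      refine Complex.continuousWithinAt_log_of_re_neg_of_im_zero
        (lt_of_le_of_ne hs.1 fun h => hw (Complex.ext h hs.2)) hs.2
  have h1 : ContinuousWithinAt (fun w => Complex.exp (Complex.log w * k))
      {w : ℂ | 0 ≤ w.im} w := (hlog.mul_const k).cexp
  refine (h1.congr_of_eventuallyEq ?_ (Complex.cpow_def_of_ne_zero hw k))
  filter_upwards [mem_nhdsWithin_of_mem_nhds (isOpen_ne.mem_nhds hw)] with z hz
  exact Complex.cpow_def_of_ne_zero hz k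

theorem tendsto_sechTransform_cpow_boundary {k m : ℂ} (hk : -1 < k.re) (hm : |m.re| < 1) (x₀ : ℝ) :
    Tendsto (fun y : ℝ => sechTransform (fun s => ((x₀ : ℂ) + y * Complex.I + s) ^ k) m)
      (𝓝[>] 0) (𝓝 (sechTransform (fun s => ((x₀ : ℂ) + s) ^ k) m)) := by
  obtain ⟨g, hg, hle⟩ := exists_integrable_bound_cpow hk x₀ (sub_pos.2 hm)
  refine tendsto_integral_filter_of_dominated_convergence _ ?_ ?_ hg ?_
  · exact .of_forall fun y => aestronglyMeasurable_sechTransform_integrand (by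
      exact (by fun_prop : Measurable
        fun s : ℝ => ((x₀ : ℂ) + y * Complex.I + s) ^ k).aestronglyMeasurable) m
  · filter_upwards [self_mem_nhdsWithin, mem_nhdsWithin_of_mem_nhds (Iic_mem_nhds one_pos)]
      with y hy0 hy1
    filter_upwards [hle y (le_of_lt hy0) hy1] with s hs
    refine (norm_sechTransform_integrand_le
      (fun s : ℝ => ((x₀ : ℂ) + y * Complex.I + s) ^ k) m s).trans ?_
    gcongr
  · filter_upwards [Measure.ae_ne volume (-x₀)] with s hs
    have hne : (x₀ : ℂ) + s ≠ 0 := by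
      intro h
      exact hs (by linarith [(by exact_mod_cast h : x₀ + s = 0)])
    have hc := Complex.continuousWithinAt_cpow_const_upper hne k
    have hp : Tendsto (fun y : ℝ => (x₀ : ℂ) + y * Complex.I + s) (𝓝[>] 0)
        (𝓝[{w : ℂ | 0 ≤ w.im}] ((x₀ : ℂ) + s)) := by
      refine tendsto_nhdsWithin_iff.2 ⟨?_, ?_⟩
      · have : Continuous fun y : ℝ => (x₀ : ℂ) + y * Complex.I + s := by fun_prop
        have := this.tendsto 0
        simp only [Complex.ofReal_zero, zero_mul, add_zero] at this
        exact this.mono_left nhdsWithin_le_nhds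
      · filter_upwards [self_mem_nhdsWithin] with y hy
        simpa using le_of_lt hy
    exact ((hc.tendsto.comp hp).const_mul _).div_const _

theorem sechTransform_ofReal_add_cpow_eq_tsum {k m : ℂ} (hk : -1 < k.re) (hm : |m.re| < 1)
    (hm0 : 0 < m.im) (x₀ : ℝ) :
    sechTransform (fun s => ((x₀ : ℂ) + s) ^ k) m =
      Real.pi * Complex.exp (m * (Real.pi / 2 * Complex.I)) *
        ∑' n : ℕ, (-Complex.exp (m * (Real.pi * Complex.I))) ^ n *
          ((x₀ : ℂ) + (Real.pi / 2 + Real.pi * n : ℝ) * Complex.I) ^ k := by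
  refine tendsto_nhds_unique (tendsto_sechTransform_cpow_boundary hk hm x₀) ?_
  set z := -Complex.exp (m * (Real.pi * Complex.I)) with hz
  have hz1 : ‖z‖ < 1 := by
    rw [hz, norm_neg, Complex.norm_exp, Real.exp_lt_one_iff]
    simpa using mul_pos hm0 Real.pi_pos
  obtain ⟨ε, hε, hr, -⟩ := exists_mul_exp_lt_one hz1 one_pos
  -- All nodes have height at least π/2, so bounding from that height is uniform in y and avoids the
  -- singularity at 0.
  have hpi2 : 0 < ((x₀ : ℂ) + (Real.pi / 2 : ℝ) * Complex.I).im := by simp [Real.pi_pos]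
  obtain ⟨C, hC0, hC⟩ := (subexpHolomorphic_cpow k hpi2).norm_shift_le hε
  have hlim : Tendsto (fun y : ℝ => ∑' n : ℕ, z ^ n *
      ((x₀ : ℂ) + y * Complex.I + (Real.pi / 2 + Real.pi * n : ℝ) * Complex.I) ^ k) (𝓝[>] 0)
      (𝓝 (∑' n : ℕ, z ^ n * ((x₀ : ℂ) + (Real.pi / 2 + Real.pi * n : ℝ) * Complex.I) ^ k)) := by
    refine tendsto_tsum_of_dominated_convergence
      ((summable_geometric_of_lt_one (by positivity) hr).mul_left (C * Real.exp ε)) ?_ ?_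
    · intro n
      have hi : 0 < Real.pi / 2 + Real.pi * n := by positivity
      have hw : ((x₀ : ℂ) + (0 : ℝ) * Complex.I +
          (Real.pi / 2 + Real.pi * n : ℝ) * Complex.I) ∈ Complex.slitPlane := by
        refine Complex.mem_slitPlane_iff.2 (Or.inr ?_)
        have : ((x₀ : ℂ) + (0 : ℝ) * Complex.I +
          (Real.pi / 2 + Real.pi * n : ℝ) * Complex.I).im = Real.pi / 2 + Real.pi * n := by
            rw [Complex.add_im, Complex.im_ofReal_mul]; simp
        rw [this]
        exact hi.ne'
      have : ContinuousAt (fun y : ℝ => ((x₀ : ℂ) + y * Complex.I +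
          (Real.pi / 2 + Real.pi * n : ℝ) * Complex.I) ^ k) 0 :=
        ContinuousAt.cpow (by fun_prop) continuousAt_const hw
      have := this.tendsto.const_mul (z ^ n)
      simp only [Complex.ofReal_zero, zero_mul, add_zero] at this
      exact this.mono_left nhdsWithin_le_nhds
    · filter_upwards [self_mem_nhdsWithin, mem_nhdsWithin_of_mem_nhds (Iic_mem_nhds one_pos)]
        with y hy0 hy1 n
      have hy0' : 0 < y := hy0
      have h1 := hC (y + Real.pi * n) 0 (by positivity)
      simp only [Complex.ofReal_zero, add_zero, abs_zero, mul_zero, Real.exp_zero, mul_one] at h1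
      have h2 : Real.exp (ε * (y + Real.pi * n)) ≤ Real.exp ε * Real.exp (ε * Real.pi) ^ n := by
        rw [← Real.exp_nat_mul, ← Real.exp_add]
        gcongr
        have : ε * y ≤ ε * 1 := by gcongr; exact hy1
        linarith
      rw [norm_mul, norm_pow, mul_pow]
      have h3 : (x₀ : ℂ) + y * Complex.I + (Real.pi / 2 + Real.pi * n : ℝ) * Complex.I =
          (x₀ : ℂ) + (Real.pi / 2 : ℝ) * Complex.I + (y + Real.pi * n : ℝ) * Complex.I := by
        push_cast; ring
      rw [h3]
      calc _ ≤ ‖z‖ ^ n * (C * (Real.exp ε * Real.exp (ε * Real.pi) ^ n)) := by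
            gcongr
            exact h1.trans (by gcongr)
        _ = _ := by ring
  refine (hlim.const_mul _).congr' ?_
  filter_upwards [self_mem_nhdsWithin] with y hy
  have hy0 : 0 < ((x₀ : ℂ) + y * Complex.I).im := by simpa using hy
  exact ((subexpHolomorphic_cpow k hy0).sechTransform_eq_tsum hm hm0).symm

/-! ### Continuation of the Lerch series -/

/-- A value on the real axis forces sin(π Re m) = 0, hence Re m = 0, and then -e^{iπm} is negative.
-/
theorem neg_exp_mem_lerchDomain {m : ℂ} (hm : |m.re| < 1) :
    -Complex.exp (m * (Real.pi * Complex.I)) ∈ lerchDomain := by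
  by_contra h
  have hpi := Real.pi_pos
  simp only [lerchDomain, mem_ofPred_eq, not_or, not_lt, not_not, Complex.neg_re, Complex.neg_im,
    neg_eq_zero] at h
  obtain ⟨h1, h2⟩ := h
  simp only [Complex.exp_re, Complex.exp_im, Complex.mul_re, Complex.mul_im, Complex.ofReal_re,
    Complex.ofReal_im, Complex.I_re, Complex.I_im, mul_zero, mul_one, zero_sub,
    add_zero, sub_self] at h1 h2
  have hb := abs_lt.1 hm
  have hs : Real.sin (m.re * Real.pi) = 0 := by
    rcases mul_eq_zero.1 h2 with h | h
    · exact absurd h (Real.exp_pos _).ne'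
    · exact h
  rw [Real.sin_eq_zero_iff_of_lt_of_lt (by nlinarith) (by nlinarith)] at hs
  rw [hs, Real.cos_zero, mul_one] at h1
  linarith [Real.exp_pos (-(m.im * Real.pi))]

/-- The identity is assumed only for Im m > 0, that is, for |z| < 1. It reaches the whole strip
because the series on the disc and J read in the variable z agree on their overlap, and together
cover the cut plane. -/
theorem lerchPhi_neg_exp_eq {s b : ℂ} {J : ℂ → ℂ}
    (hJ : ∀ m : ℂ, |m.re| < 1 → DifferentiableAt ℂ J m)
    (hd : DifferentiableOn ℂ (fun z => lerchSeries z s b) (Metric.ball 0 1))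
    (heq : ∀ m : ℂ, |m.re| < 1 → 0 < m.im →
      J m = lerchSeries (-Complex.exp (m * (Real.pi * Complex.I))) s b)
    {m : ℂ} (hm : |m.re| < 1) :
    lerchPhi (-Complex.exp (m * (Real.pi * Complex.I))) s b = J m := by
  have hpiI : (Real.pi * Complex.I : ℂ) ≠ 0 :=
    mul_ne_zero (by exact_mod_cast Real.pi_ne_zero) Complex.I_ne_zero
  -- The inverse of m ↦ -e^{iπm}. It is holomorphic where -z lies in the slit plane, i.e. off [0,
  -- ∞).
  set μ : ℂ → ℂ := fun z => Complex.log (-z) / (Real.pi * Complex.I) with hμ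
  have hμeq : ∀ z : ℂ, μ z =
      ((-z).arg / Real.pi : ℝ) - (Real.log ‖z‖ / Real.pi : ℝ) * Complex.I := by
    intro z
    have hpi : (Real.pi : ℂ) ≠ 0 := by exact_mod_cast Real.pi_ne_zero
    rw [hμ]
    simp only [Complex.log, norm_neg]
    rw [div_eq_iff hpiI]
    push_cast
    field_simp
    linear_combination (Real.log ‖z‖ : ℂ) * Complex.I_sq
  have hμre : ∀ z : ℂ, (μ z).re = (-z).arg / Real.pi := by
    intro z
    rw [hμeq, Complex.sub_re, Complex.re_ofReal_mul, Complex.ofReal_re, Complex.I_re, mul_zero,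
      sub_zero]
  have hμim : ∀ z : ℂ, (μ z).im = -(Real.log ‖z‖ / Real.pi) := by
    intro z
    rw [hμeq, Complex.sub_im, Complex.im_ofReal_mul, Complex.ofReal_im, Complex.I_im, mul_one,
      zero_sub]
  have hμs : ∀ z : ℂ, -z ∈ Complex.slitPlane → |(μ z).re| < 1 := by
    intro z hz
    rw [hμre, abs_div, abs_of_pos Real.pi_pos, div_lt_one Real.pi_pos]
    exact lt_of_le_of_ne (Complex.abs_arg_le_pi _) fun h => by
      rcases (abs_eq Real.pi_pos.le).1 h with h | h
      · exact (Complex.mem_slitPlane_iff_arg.1 hz).1 h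
      · exact absurd h (Complex.neg_pi_lt_arg _).ne'
  have hexp : ∀ z : ℂ, z ≠ 0 → -Complex.exp (μ z * (Real.pi * Complex.I)) = z := by
    intro z hz
    rw [hμ]
    simp only
    rw [div_mul_cancel₀ _ hpiI, Complex.exp_log (neg_ne_zero.2 hz), neg_neg]
  have hagree : ∀ z : ℂ, -z ∈ Complex.slitPlane → ‖z‖ < 1 → J (μ z) = lerchSeries z s b := by
    intro z hz hz1
    have hz0 : z ≠ 0 := neg_ne_zero.1 (Complex.slitPlane_ne_zero hz)
    rw [heq _ (hμs z hz) ?_, hexp z hz0]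
    rw [hμim, neg_pos]
    exact div_neg_of_neg_of_pos (Real.log_neg (norm_pos_iff.2 hz0) hz1) Real.pi_pos
  classical
  -- The series is indispensable on [0, 1), where μ jumps; a point of the cut plane with ‖z‖ ≥ 1 is
  -- never in [0, ∞).
  set F : ℂ → ℂ := fun z => if ‖z‖ < 1 then lerchSeries z s b else J (μ z) with hF
  have hFslit : ∀ z : ℂ, -z ∈ Complex.slitPlane → F z = J (μ z) := by
    intro z hz
    by_cases h : ‖z‖ < 1
    · rw [hF]; simp only [if_pos h]; exact (hagree z hz h).symm
    · rw [hF]; simp only [if_neg h]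
  have hcont : IsLerchContinuation s b F := by
    refine ⟨fun z hz => ?_, fun z hz => by rw [hF]; simp only [if_pos hz]⟩
    refine DifferentiableAt.differentiableWithinAt ?_
    by_cases h : ‖z‖ < 1
    · have hb : Metric.ball (0 : ℂ) 1 ∈ 𝓝 z := Metric.isOpen_ball.mem_nhds (by simpa using h)
      refine (hd.differentiableAt hb).congr_of_eventuallyEq ?_
      filter_upwards [hb] with w hw
      rw [hF]; simp only [if_pos (by simpa using hw : ‖w‖ < 1)]
    · have hsl : -z ∈ Complex.slitPlane := by
        rw [Complex.mem_slitPlane_iff, Complex.neg_re, Complex.neg_im, neg_ne_zero]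
        rcases hz with hz | hz
        · by_cases him : z.im = 0
          · left
            rw [not_lt, ← Complex.re_add_im z, him, Complex.ofReal_zero, zero_mul, add_zero,
              Complex.norm_real, Real.norm_eq_abs] at h
            rcases le_abs.1 h with h | h <;> linarith
          · exact Or.inr him
        · exact Or.inr hz
      have hnear : ∀ᶠ w in 𝓝 z, -w ∈ Complex.slitPlane :=
        (continuous_neg.tendsto z).eventually (Complex.isOpen_slitPlane.mem_nhds hsl)
      have h1 : DifferentiableAt ℂ μ z :=
        ((differentiableAt_id.neg).clog hsl).div_const _
      refine DifferentiableAt.congr_of_eventuallyEq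
        (f := fun w => J (μ w)) ((hJ (μ z) (hμs z hsl)).comp z h1) ?_
      filter_upwards [hnear] with w hw using hFslit w hw
  rw [hcont.lerchPhi_eq (neg_exp_mem_lerchDomain hm)]
  have him : (m * (Real.pi * Complex.I)).im = m.re * Real.pi := by simp
  have hb := abs_lt.1 hm
  have hpi := Real.pi_pos
  have hlog : Complex.log (Complex.exp (m * (Real.pi * Complex.I))) = m * (Real.pi * Complex.I) :=
    Complex.log_exp (by rw [him]; nlinarith) (by rw [him]; nlinarith)
  rw [hFslit _ ?_]
  · congr 1
    rw [hμ]
    simp only [neg_neg]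
    rw [hlog, mul_div_cancel_right₀ _ hpiI]
  · rw [neg_neg, Complex.mem_slitPlane_iff_arg]
    refine ⟨?_, Complex.exp_ne_zero _⟩
    rw [← Complex.log_im, hlog, him]
    exact (by nlinarith : m.re * Real.pi < Real.pi).ne

theorem differentiableOn_lerchSeries {s b : ℂ}
    (h : ∀ r : ℝ, 0 ≤ r → r < 1 → Summable fun n : ℕ => r ^ n * ‖1 / (b + n) ^ s‖) :
    DifferentiableOn ℂ (fun z => lerchSeries z s b) (Metric.ball 0 1) := by
  intro z hz
  obtain ⟨r, hzr, hr1⟩ := exists_between (mem_ball_zero_iff.1 hz)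
  have hd : DifferentiableOn ℂ (fun z => lerchSeries z s b) (Metric.ball 0 r) := by
    refine Complex.differentiableOn_tsum_of_summable_norm
      (h r ((norm_nonneg z).trans hzr.le) hr1) (fun n => by fun_prop) Metric.isOpen_ball ?_
    intro n w hw
    rw [div_eq_mul_one_div, norm_mul, norm_pow]
    gcongr
    exact (mem_ball_zero_iff.1 hw).le
  exact (hd.differentiableAt (Metric.isOpen_ball.mem_nhds
    (by simpa using hzr))).differentiableWithinAt

/-! ### Reduction of the segment integral to the real line -/

theorem Complex.ofReal_sigmoid (s : ℝ) :
    (Real.sigmoid s : ℂ) = Complex.exp s / (1 + Complex.exp s) := by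
  have h1 : (1 + Complex.exp (s : ℂ)) ≠ 0 := by
    have : (0 : ℝ) < 1 + Real.exp s := by positivity
    exact_mod_cast this.ne'
  have h2 : (Complex.exp (s : ℂ) + 1) ≠ 0 := by rwa [add_comm]
  have h0 := Complex.exp_ne_zero (s : ℂ)
  rw [Real.sigmoid_def]
  push_cast
  rw [Complex.exp_neg]
  field_simp
  ring

/-- Substitution t = σ(s), with σ' = σ(1 - σ) and range exactly (0, 1). -/
theorem intervalIntegrable_iff_integrable_sigmoid {F : ℝ → ℂ} :
    IntervalIntegrable F volume 0 1 ↔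
      Integrable fun s : ℝ =>
        (Real.sigmoid s * (1 - Real.sigmoid s)) • F (Real.sigmoid s) := by
  rw [intervalIntegrable_iff_integrableOn_Ioo_of_le zero_le_one, ← Real.range_sigmoid,
    ← image_univ, integrableOn_image_iff_integrableOn_abs_deriv_smul MeasurableSet.univ
      (fun x _ => (Real.hasDerivAt_sigmoid x).hasDerivWithinAt)
      Real.sigmoid_injective.injOn, integrableOn_univ]
  refine integrable_congr (.of_forall fun s => ?_)
  simp only
  rw [abs_of_pos (mul_pos (Real.sigmoid_pos s) (sub_pos.2 (Real.sigmoid_lt_one s)))]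

theorem intervalIntegral_eq_integral_sigmoid (F : ℝ → ℂ) :
    ∫ t in (0 : ℝ)..1, F t =
      ∫ s : ℝ, (Real.sigmoid s * (1 - Real.sigmoid s)) • F (Real.sigmoid s) := by
  rw [intervalIntegral.integral_of_le zero_le_one, integral_Ioc_eq_integral_Ioo,
    ← Real.range_sigmoid, ← image_univ,
    integral_image_eq_integral_abs_deriv_smul MeasurableSet.univ
      (fun x _ => (Real.hasDerivAt_sigmoid x).hasDerivWithinAt)
      Real.sigmoid_injective.injOn, setIntegral_univ]
  refine integral_congr_ae (.of_forall fun s => ?_)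
  simp only
  rw [abs_of_pos (mul_pos (Real.sigmoid_pos s) (sub_pos.2 (Real.sigmoid_lt_one s)))]

theorem sigmoid_smul_segment_integrand {α a : ℂ} (hα : α ≠ 0) (ha : a ≠ 0) (m k : ℂ) (s : ℝ) :
    (Real.sigmoid s * (1 - Real.sigmoid s)) •
      ((fun x : ℂ => ((α + x) / (α - x)) ^ m * Complex.log (a * (α + x) / (α - x)) ^ k
          / (α ^ 2 + x ^ 2)) (-α + (Real.sigmoid s : ℂ) * (α - -α)) * (α - -α)) =
    α⁻¹ * (Complex.exp (m * s) * (Complex.log a + s) ^ k / (2 * Complex.cosh (s : ℂ))) := by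
  set E := Complex.exp (s : ℂ) with hE
  have hE0 : E ≠ 0 := Complex.exp_ne_zero _
  have hEr : E = (Real.exp s : ℂ) := by rw [hE]; push_cast; rfl
  have h1 : 1 + E ≠ 0 := by
    have : (0 : ℝ) < 1 + Real.exp s := by positivity
    rw [hEr]; exact_mod_cast this.ne'
  have h2 : 1 + E ^ 2 ≠ 0 := by
    have : (0 : ℝ) < 1 + Real.exp s ^ 2 := by positivity
    rw [hEr]; exact_mod_cast this.ne'
  have hplus : α + (-α + (Real.sigmoid s : ℂ) * (α - -α)) = 2 * α * E / (1 + E) := by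
    rw [Complex.ofReal_sigmoid]; ring
  have hminus : α - (-α + (Real.sigmoid s : ℂ) * (α - -α)) = 2 * α / (1 + E) := by
    rw [Complex.ofReal_sigmoid, ← hE]
    rw [eq_div_iff h1]
    linear_combination (-2 * α) * div_mul_cancel₀ E h1
  have hx : -α + (Real.sigmoid s : ℂ) * (α - -α) = α * (E - 1) / (1 + E) := by
    rw [Complex.ofReal_sigmoid, ← hE, eq_div_iff h1]
    linear_combination (2 * α) * div_mul_cancel₀ E h1
  have hden : α ^ 2 + (-α + (Real.sigmoid s : ℂ) * (α - -α)) ^ 2 =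
      2 * α ^ 2 * (1 + E ^ 2) / (1 + E) ^ 2 := by
    rw [hx, div_pow, eq_div_iff (pow_ne_zero 2 h1), add_mul, div_mul_cancel₀ _ (pow_ne_zero 2 h1)]
    ring
  have hq : 2 * α * E / (1 + E) / (2 * α / (1 + E)) = E := by
    rw [div_div_div_cancel_right₀ h1, mul_div_cancel_left₀ _ (mul_ne_zero two_ne_zero hα)]
  have hpow : E ^ m = Complex.exp (m * s) := by
    rw [Complex.cpow_def_of_ne_zero hE0, hEr, ← Complex.ofReal_log (Real.exp_pos s).le,
      Real.log_exp, mul_comm]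
  have hlog : Complex.log (a * E) = Complex.log a + s := by
    rw [hEr, Complex.log_mul_ofReal _ (Real.exp_pos s) _ ha, Real.log_exp, add_comm]
  have hcosh : 2 * Complex.cosh (s : ℂ) = (1 + E ^ 2) / E := by
    rw [Complex.two_mul_cosh, Complex.exp_neg, ← hE]
    field_simp
    ring
  simp only
  rw [hplus, hminus, hden, mul_div_assoc a, hq, hpow, hlog, hcosh, Complex.real_smul]
  push_cast
  rw [Complex.ofReal_sigmoid, ← hE]
  have hs : E / (1 + E) * (1 - E / (1 + E)) = E / (1 + E) ^ 2 := by
    rw [eq_div_iff (pow_ne_zero 2 h1)]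
    field_simp
    ring
  rw [hs]
  field_simp
  ring

/-! ### Powers and the Lerch series -/

/-- For Re u > 0 the argument of iu is π/2 + arg u, still inside (-π, π], so the logarithms add
without a 2πi correction. -/
theorem Complex.pi_mul_I_mul_cpow {u : ℂ} (hu : 0 < u.re) (k : ℂ) :
    (Real.pi * Complex.I * u) ^ k =
      (Real.pi : ℂ) ^ k * Complex.exp (Complex.I * Real.pi * k / 2) * u ^ k := by
  have hpi : (Real.pi : ℂ) ≠ 0 := by exact_mod_cast Real.pi_ne_zero
  have hu0 : u ≠ 0 := fun h => by simp [h] at hu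
  have harg : Complex.arg Complex.I + Complex.arg u ∈ Ioc (-Real.pi) Real.pi := by
    have := abs_lt.1 (Complex.abs_arg_lt_pi_div_two_iff.2 (Or.inl hu))
    rw [Complex.arg_I]
    constructor <;> linarith [Real.pi_pos]
  have hlog : Complex.log (Real.pi * Complex.I * u) =
      Complex.log Real.pi + Real.pi / 2 * Complex.I + Complex.log u := by
    rw [mul_assoc, Complex.log_ofReal_mul Real.pi_pos (mul_ne_zero Complex.I_ne_zero hu0),
      (Complex.log_mul_eq_add_log_iff Complex.I_ne_zero hu0).2 harg, Complex.log_I,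
      Complex.ofReal_log Real.pi_pos.le, add_assoc]
  rw [Complex.cpow_def_of_ne_zero (mul_ne_zero (mul_ne_zero hpi Complex.I_ne_zero) hu0), hlog,
    Complex.cpow_def_of_ne_zero hpi, Complex.cpow_def_of_ne_zero hu0, ← Complex.exp_add,
    ← Complex.exp_add]
  ring_nf

/-- Integer powers are multiplicative for every u. This is needed when arg a ≤ -π/2, where Re b ≤ 0.
-/
theorem Complex.pi_mul_I_mul_cpow_natCast (u : ℂ) (n : ℕ) :
    (Real.pi * Complex.I * u) ^ (n : ℂ) =
      (Real.pi : ℂ) ^ (n : ℂ) * Complex.exp (Complex.I * Real.pi * n / 2) * u ^ (n : ℂ) := by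
  have h : Complex.exp (Complex.I * Real.pi * n / 2) = Complex.I ^ n := by
    rw [show Complex.I * Real.pi * n / 2 = n * (Real.pi / 2 * Complex.I) by ring,
      Complex.exp_nat_mul, Complex.exp_pi_div_two_mul_I]
  rw [h]
  simp only [Complex.cpow_natCast]
  ring

/-- Holds at y = 0 as well, which settles the n = 0 term when b = 0: it is read as 0^k, with 0^0 =
1. -/
theorem div_cpow_neg (x y k : ℂ) : x / y ^ (-k) = x * y ^ k := by
  rw [Complex.cpow_neg, div_inv_eq_mul]

/-! ### The integral formula -/

theorem theorem3p7 (α m k a : ℂ) (hα : α ≠ 0) (ha : a ≠ 0) (hm : |m.re| < 1)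
    (hak : 0 < a.arg ∨ (a.arg = 0 ∧ -1 < k.re) ∨ ∃ n : ℕ, k = n) :
    SegmentIntegrable
        (fun x : ℂ => ((α + x) / (α - x)) ^ m * Complex.log (a * (α + x) / (α - x)) ^ k
          / (α ^ 2 + x ^ 2)) (-α) α ∧
      segmentIntegral
        (fun x : ℂ => ((α + x) / (α - x)) ^ m * Complex.log (a * (α + x) / (α - x)) ^ k
          / (α ^ 2 + x ^ 2)) (-α) α
      = (Real.pi : ℂ) ^ (k + 1) * Complex.exp (Complex.I * Real.pi * (k + m) / 2)
          * lerchPhi (-Complex.exp (Complex.I * m * Real.pi)) (-k)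
              (1 / 2 - Complex.I * Complex.log a / Real.pi)
          / α := by
  set L := Complex.log a with hL
  set b : ℂ := 1 / 2 - Complex.I * L / Real.pi with hb
  have hLim : L.im = a.arg := Complex.log_im a
  have hpi : (Real.pi : ℂ) ≠ 0 := by exact_mod_cast Real.pi_ne_zero
  have hnode : ∀ n : ℕ, L + (Real.pi / 2 + Real.pi * n : ℝ) * Complex.I =
      Real.pi * Complex.I * (b + n) := by
    intro n
    rw [hb]
    push_cast
    field_simp
    linear_combination (2 * L) * Complex.I_sq
  have hbre : b.re = 1 / 2 + a.arg / Real.pi := by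
    have : b = 1 / 2 - Complex.I * (L / (Real.pi : ℝ)) := by rw [hb]; ring
    rw [this, Complex.sub_re, Complex.I_mul_re, Complex.div_ofReal_im, hLim]
    norm_num
  set φ : ℝ → ℂ := fun s => (L + s) ^ k with hφ
  -- Everything that depends on the case: convergence, the residue series for Im m > 0, growth of
  -- w^k at the nodes, and extraction of (πi)^k from the power.
  obtain ⟨hsub, hser, hhol, hpow⟩ : SubexpIntegrable φ ∧
      (∀ m : ℂ, |m.re| < 1 → 0 < m.im → sechTransform φ m =
        Real.pi * Complex.exp (m * (Real.pi / 2 * Complex.I)) *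
          ∑' n : ℕ, (-Complex.exp (m * (Real.pi * Complex.I))) ^ n *
            (L + (Real.pi / 2 + Real.pi * n : ℝ) * Complex.I) ^ k) ∧
      SubexpHolomorphic (fun w => w ^ k) (L + (Real.pi / 2 : ℝ) * Complex.I).im ∧
      ∀ n : ℕ, (Real.pi * Complex.I * (b + n)) ^ k =
        (Real.pi : ℂ) ^ k * Complex.exp (Complex.I * Real.pi * k / 2) * (b + n) ^ k := by
    have him : (L + (Real.pi / 2 : ℝ) * Complex.I).im = a.arg + Real.pi / 2 := by
      rw [Complex.add_im, Complex.im_ofReal_mul, hLim, Complex.I_im, mul_one]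
    have hupper : 0 ≤ a.arg → SubexpHolomorphic (fun w => w ^ k)
        (L + (Real.pi / 2 : ℝ) * Complex.I).im ∧ ∀ n : ℕ, (Real.pi * Complex.I * (b + n)) ^ k =
        (Real.pi : ℂ) ^ k * Complex.exp (Complex.I * Real.pi * k / 2) * (b + n) ^ k := by
      intro h0
      refine ⟨subexpHolomorphic_cpow k (by rw [him]; linarith [Real.pi_pos]), fun n => ?_⟩
      refine Complex.pi_mul_I_mul_cpow ?_ k
      rw [Complex.add_re, hbre, Complex.natCast_re]
      positivity
    rcases hak with h | ⟨h, hk⟩ | ⟨n, rfl⟩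
    · have hh := subexpHolomorphic_cpow k (y := L.im) (by rwa [hLim])
      exact ⟨hh.subexpIntegrable, fun m hm hm0 => hh.sechTransform_eq_tsum hm hm0, hupper h.le⟩
    · have hLr : L = (L.re : ℂ) := Complex.ext rfl (by rw [hLim, h, Complex.ofReal_im])
      refine ⟨?_, fun m hm hm0 => ?_, hupper h.ge⟩
      · rw [hφ, hLr]; exact subexpIntegrable_ofReal_add_cpow hk L.re
      · rw [hφ, hLr]; exact sechTransform_ofReal_add_cpow_eq_tsum hk hm hm0 L.re
    · have hh := subexpHolomorphic_cpow_natCast n L.im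
      exact ⟨hh.subexpIntegrable, fun m hm hm0 => hh.sechTransform_eq_tsum hm hm0,
        subexpHolomorphic_cpow_natCast n _, fun j => Complex.pi_mul_I_mul_cpow_natCast _ n⟩
  set K : ℂ := Real.pi * ((Real.pi : ℂ) ^ k * Complex.exp (Complex.I * Real.pi * k / 2)) with hK
  have hκ : (Real.pi : ℂ) ^ k * Complex.exp (Complex.I * Real.pi * k / 2) ≠ 0 :=
    mul_ne_zero (by rw [Complex.cpow_def_of_ne_zero hpi]; exact Complex.exp_ne_zero _)
      (Complex.exp_ne_zero _)
  have hK0 : K ≠ 0 := mul_ne_zero hpi hκ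
  -- Dividing by the nonvanishing entire factor K e^{iπm/2} turns the residue series into the bare
  -- Lerch series.
  have hΦ : lerchPhi (-Complex.exp (m * (Real.pi * Complex.I))) (-k) b =
      sechTransform φ m / (K * Complex.exp (m * (Real.pi / 2 * Complex.I))) := by
    refine lerchPhi_neg_exp_eq
      (J := fun m => sechTransform φ m / (K * Complex.exp (m * (Real.pi / 2 * Complex.I))))
      (fun m hm => ?_) ?_ (fun m hm hm0 => ?_) hm
    · exact (hsub.differentiableAt_sechTransform hm).div (by fun_prop)
        (mul_ne_zero hK0 (Complex.exp_ne_zero _))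
    · refine differentiableOn_lerchSeries fun r hr0 hr1 => ?_
      have h1 : ‖(r : ℂ)‖ = r := by rw [Complex.norm_real, Real.norm_of_nonneg hr0]
      have h2 := (hhol.summable_pow_mul (z := (r : ℂ)) (by rwa [h1]) le_rfl).mul_left
        ‖(Real.pi : ℂ) ^ k * Complex.exp (Complex.I * Real.pi * k / 2)‖⁻¹
      refine h2.congr fun n => ?_
      have h3 : L + (Real.pi / 2 : ℝ) * Complex.I + (0 + Real.pi * n : ℝ) * Complex.I =
          Real.pi * Complex.I * (b + n) := by
        rw [← hnode]; push_cast; ring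
      rw [h1, h3, hpow, norm_mul _ ((b + n) ^ k), div_cpow_neg, one_mul, mul_left_comm,
        inv_mul_cancel_left₀ (norm_ne_zero_iff.2 hκ)]
    · rw [div_eq_iff (mul_ne_zero hK0 (Complex.exp_ne_zero _)), hser m hm hm0, lerchSeries]
      simp only [hnode, hpow, div_cpow_neg, mul_left_comm _
        ((Real.pi : ℂ) ^ k * Complex.exp (Complex.I * Real.pi * k / 2)), tsum_mul_left]
      rw [hK]
      ring
  have hint := sigmoid_smul_segment_integrand hα ha m k
  constructor
  · rw [SegmentIntegrable, intervalIntegrable_iff_integrable_sigmoid]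
    simp only [hint]
    exact (hsub.integrable_sechTransform hm).const_mul _
  · rw [segmentIntegral, intervalIntegral_eq_integral_sigmoid]
    simp only [hint]
    rw [integral_const_mul, ← sechTransform.eq_1 φ m]
    have e1 : Complex.I * m * Real.pi = m * (Real.pi * Complex.I) := by ring
    have e2 : (Real.pi : ℂ) ^ (k + 1) * Complex.exp (Complex.I * Real.pi * (k + m) / 2) =
        K * Complex.exp (m * (Real.pi / 2 * Complex.I)) := by
      rw [Complex.cpow_add _ _ hpi, Complex.cpow_one, hK,
        show Complex.I * Real.pi * (k + m) / 2 =
          Complex.I * Real.pi * k / 2 + m * (Real.pi / 2 * Complex.I) by ring, Complex.exp_add]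
      ring
    rw [e1, e2, hΦ, mul_div_cancel₀ _ (mul_ne_zero hK0 (Complex.exp_ne_zero _)), inv_mul_eq_div]
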